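/- Let $\mathcal S$ and $\mathcal T$ be triangulated categories with countable direct sums, and let $E\colon\mathcal S\to\mathcal T$ and $F\colon\mathcal T\to\mathcal S$ be exact functors compatible with countable direct sums, with $E$ left adjoint to $F$. Let $\mathcal I=\ker F$, i.e. $\mathcal I(A,B)=\{f\in\mathcal T(A,B): F(f)=0\}$, and let $L=EF$ be the associated comonad on $\mathcal T$, with counit $\epsilon$. An object $P\in\mathcal T$ is called $\mathcal I$-projective if $\mathcal I(P,B)=0$ for all $B\in\mathcal T$, and $\mathcal N_{\mathcal I}$ denotes the full subcategory of the $\mathcal I$-contractible objects $N$, i.e. those with $\mathrm{id}_N\in\mathcal I(N,N)$. (1) For every $A\in\mathcal T$ the comonad bar construction $P_n=L^{n+1}A$ ($n\ge 0$), with boundary maps $\delta_n=\sum_{i=0}^n(-1)^iL^i(\epsilon_{L^{n-i}A})\colon P_n\to P_{n-1}$ for $n\ge1$ and augmentation $\delta_0=\epsilon_A\colon P_0\to A$, is an $\mathcal I$-projective resolution of $A$: every $P_n$ is $\mathcal I$-projective, $\cdots\to P_1\to P_0\to A$ is a chain complex, and the complex $\cdots\to F(P_1)\to F(P_0)\to F(A)\to0$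 is contractible by a chain homotopy in $\mathcal S$. (2) Let $\langle E\mathcal S\rangle$ be the localizing subcategory generated by the objects $EX$, $X\in\mathcal S$, i.e. the smallest strictly full triangulated subcategory of $\mathcal T$ that contains them and is closed under countable direct sums. Then the pair $(\langle E\mathcal S\rangle,\mathcal N_{\mathcal I})$ is complementary: both are triangulated subcategories of $\mathcal T$ closed under direct summands, $\mathcal T(P,N)=0$ for all $P\in\langle E\mathcal S\rangle$ and $N\in\mathcal N_{\mathcal I}$, and every $A\in\mathcal T$ fits into an exact triangle $P_A\to A\to N_A\to\Sigma P_A$ with $P_A\in\langle E\mathcal S\rangle$ and $N_A\in\mathcal N_{\mathcal I}$. -/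

import Mathlib

open CategoryTheory CategoryTheory.Limits CategoryTheory.Pretriangulated

namespace HomologicalIdeal

section Ideals

variable {T : Type*} [Category* T] [Preadditive T] {S : Type*} [Category* S] [Preadditive S]

/-- The kernel of a functor `F` on morphisms: `f` belongs to it iff `F f = 0`. -/
def kerIdeal (F : T ⥤ S) : MorphismProperty T := fun _ _ f => F.map f = 0

/-- `P` is projective for a class `I` of morphisms if `I(P, A) = 0` for all objects `A`. -/
def IsProjective (I : MorphismProperty T) (P : T) : Prop :=
  ∀ ⦃A : T⦄ (f : P ⟶ A), I f → f = 0

/-- The `I`-contractible objects: those `N` whose identity belongs to `I`. -/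
def contractibleObjects (I : MorphismProperty T) : ObjectProperty T := fun N => I (𝟙 N)

/-- For `I = ker F`, the chain complex `P` together with `δ₀ : P₀ ⟶ A` is an `I`-projective
resolution of `A`: each `P_n` is `I`-projective, `… ⟶ P₁ ⟶ P₀ ⟶ A` is a complex, and
its image `… ⟶ F P₁ ⟶ F P₀ ⟶ F A ⟶ 0` is contractible by a chain homotopy. -/
def IsProjectiveResolution (F : T ⥤ S) [F.Additive] {A : T} (P : ChainComplex T ℕ)
    (δ₀ : P.X 0 ⟶ A) : Prop :=
  (∀ n, IsProjective (kerIdeal F) (P.X n)) ∧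
    ∃ w : P.d 1 0 ≫ δ₀ = 0,
      Nonempty (Homotopy
        (𝟙 ((F.mapHomologicalComplex (ComplexShape.down ℕ)).obj (P.augment δ₀ w))) 0)

end Ideals

section Bar

variable {T : Type*} [Category* T]

/-- The iterates `Lⁿ A` of a comonad `L`. -/
def barObj (L : Comonad T) (A : T) : ℕ → T
  | 0 => A
  | n + 1 => L.obj (barObj L A n)

/-- The counit `ε_{L^n A} : L^{n+1} A ⟶ L^n A`. -/
def barCounit (L : Comonad T) (A : T) (n : ℕ) : barObj L A (n + 1) ⟶ barObj L A n :=
  L.ε.app (barObj L A n)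

/-- `L` applied to a morphism `L^m A ⟶ L^n A`. -/
def barMap (L : Comonad T) (A : T) {m n : ℕ} (f : barObj L A m ⟶ barObj L A n) :
    barObj L A (m + 1) ⟶ barObj L A (n + 1) :=
  L.map f

lemma barMap_comp_barCounit (L : Comonad T) (A : T) {m n : ℕ}
    (f : barObj L A m ⟶ barObj L A n) :
    barMap L A f ≫ barCounit L A n = barCounit L A m ≫ f :=
  L.ε.naturality f

variable [Preadditive T]

/-- The face morphisms `L^i(ε_{L^{n-i} A}) : L^{n+1} A ⟶ L^n A`, for `0 ≤ i ≤ n`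
(and `0` for `i > n`). -/
def barFace (L : Comonad T) (A : T) : (n i : ℕ) → (barObj L A (n + 1) ⟶ barObj L A n)
  | n, 0 => barCounit L A n
  | n + 1, i + 1 => barMap L A (barFace L A n i)
  | 0, _ + 1 => 0

/-- The alternating sum of the faces, `δ_n : L^{n+1} A ⟶ L^n A`. -/
def barDiff (L : Comonad T) (A : T) (n : ℕ) : barObj L A (n + 1) ⟶ barObj L A n :=
  ∑ i ∈ Finset.range (n + 1), (-1 : ℤ) ^ i • barFace L A n i

lemma barDiff_zero (L : Comonad T) (A : T) : barDiff L A 0 = barCounit L A 0 := by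
  simp [barDiff, barFace]

lemma barDiff_succ (L : Comonad T) [L.toFunctor.Additive] (A : T) (n : ℕ) :
    barDiff L A (n + 1) = barCounit L A (n + 1) - barMap L A (barDiff L A n) := by
  have h : barMap L A (barDiff L A n) =
      ∑ i ∈ Finset.range (n + 1), (-1 : ℤ) ^ i • barMap L A (barFace L A n i) := by
    rw [barDiff, barMap, Functor.map_sum]
    exact Finset.sum_congr rfl fun i _ => Functor.map_zsmul _
  rw [h, barDiff, Finset.sum_range_succ', sub_eq_add_neg, ← Finset.sum_neg_distrib]
  refine (add_comm _ _).trans ?_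
  congr 1
  · simp [barFace]
  · refine Finset.sum_congr rfl fun i _ => ?_
    rw [pow_succ, mul_neg_one, neg_smul]
    rfl

lemma barDiff_comp (L : Comonad T) [L.toFunctor.Additive] (A : T) (n : ℕ) :
    barDiff L A (n + 1) ≫ barDiff L A n = 0 := by
  induction n with
  | zero =>
    rw [barDiff_succ, barDiff_zero, Preadditive.sub_comp, barMap_comp_barCounit, sub_self]
  | succ n ih =>
    have h : barMap L A (barDiff L A (n + 1)) ≫ barMap L A (barDiff L A n) = 0 := by
      refine (L.map_comp _ _).symm.trans ?_
      rw [ih]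
      exact L.map_zero _ _
    rw [barDiff_succ L A (n + 1), Preadditive.sub_comp]
    nth_rewrite 3 [barDiff_succ L A n]
    rw [Preadditive.comp_sub, h, sub_zero, barMap_comp_barCounit, sub_self]

/-- The (unaugmented) bar complex `… ⟶ L³ A ⟶ L² A ⟶ L A`: in degree `n` it is
`P_n = L^{n+1} A`. Its augmentation is the counit `ε_A : L A ⟶ A`. -/
def barComplex (L : Comonad T) [L.toFunctor.Additive] (A : T) : ChainComplex T ℕ :=
  ChainComplex.of (fun n => barObj L A (n + 1)) (fun n => barDiff L A (n + 1))
    (fun n => barDiff_comp L A (n + 1))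

end Bar

instance toComonad_additive {T : Type*} [Category* T] [Preadditive T] {S : Type*} [Category* S]
    [Preadditive S] {E : S ⥤ T} {F : T ⥤ S} [E.Additive] [F.Additive] (adj : E ⊣ F) :
    adj.toComonad.toFunctor.Additive :=
  inferInstanceAs (F ⋙ E).Additive

section Triangulated

variable {T : Type*} [Category* T] [Preadditive T] [HasZeroObject T] [HasShift T ℤ]
  [∀ n : ℤ, (shiftFunctor T n).Additive] [Pretriangulated T]

/-- Localizing subcategories: (strictly full) triangulated subcategories closed under countable
direct sums. -/
structure IsLocalizing (P : ObjectProperty T) : Prop where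
  isTriangulated : P.IsTriangulated
  iso_closed : P.IsClosedUnderIsomorphisms
  sum_closed : P.IsClosedUnderColimitsOfShape (Discrete ℕ)

/-- The smallest localizing subcategory containing the objects in `P`. -/
def localizingClosure (P : ObjectProperty T) : ObjectProperty T :=
  fun X => ∀ Q : ObjectProperty T, IsLocalizing Q → P ≤ Q → Q X

/-- Complementary pairs of thick triangulated subcategories. -/
structure IsComplementary (L N : ObjectProperty T) : Prop where
  left_triangulated : L.IsTriangulated
  left_thick : L.IsStableUnderRetracts
  right_triangulated : N.IsTriangulated
  right_thick : N.IsStableUnderRetracts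
  hom_eq_zero : ∀ ⦃P M : T⦄, L P → N M → ∀ f : P ⟶ M, f = 0
  exists_triangle : ∀ A : T, ∃ (P M : T) (_ : L P) (_ : N M)
    (f : P ⟶ A) (g : A ⟶ M) (h : M ⟶ P⟦(1 : ℤ)⟧), Triangle.mk f g h ∈ distTriang T

end Triangulated

end HomologicalIdeal

/-! Resolution: the bar differentials satisfy `δ_{n+1} = ε - L(δ_n)` (`barDiff_succ`). After
applying `F`, the unit `η` at `F Lⁿ A` is a contraction: a triangle identity handles `ε`, and
naturality of `η` cancels the remaining term (`map_barDiff_comp_barUnit_add`).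

Complementarity: the contractible objects are those with `F N = 0`, and `T(EX, N) ≅ S(X, F N)`, so
orthogonality passes from the generators to the localizing subcategory. For the triangle on `A`, set
`N_0 = A` and let `N_{n+1}` be the cone of the counit `EF N_n ⟶ N_n`; each `N_n ⟶ N_{n+1}` is killed
by `F` and has its cone in `⟨ES⟩`. Let `M` be the homotopy colimit, the cone of `id - shift` on `∐
N_n`. Since `F` turns `id - shift` into `id`, `F M = 0` (`map_telescopeMap`). Since `A` is the
homotopy colimit of its constant sequence, the maps `A ⟶ N_n` induce `A ⟶ M` with cone in `⟨ES⟩`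
(`trW_sigma_map`, `exists_trW_kernel`). -/

namespace HomologicalIdeal

/-! ### Contractions of chain complexes. -/

section Contraction

variable {C : Type*} [Category* C] [Preadditive C]

/-- A chain complex with a contraction `s` in each degree is contractible. -/
noncomputable def homotopyOfContraction (K : ChainComplex C ℕ) (s : ∀ n, K.X n ⟶ K.X (n + 1))
    (h₀ : s 0 ≫ K.d 1 0 = 𝟙 _)
    (hs : ∀ n, K.d (n + 1) n ≫ s n + s (n + 1) ≫ K.d (n + 2) (n + 1) = 𝟙 _) :
    Homotopy (𝟙 K) 0 where
  hom i j := if h : i + 1 = j then s i ≫ eqToHom (by rw [h]) else 0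
  zero i j h := dif_neg h
  comm i := by
    cases i with
    | zero =>
      rw [prevD_eq _ (show (ComplexShape.down ℕ).Rel 1 0 from rfl)]
      simp [h₀]
    | succ n =>
      rw [dNext_eq _ (show (ComplexShape.down ℕ).Rel (n + 1) n from rfl),
        prevD_eq _ (show (ComplexShape.down ℕ).Rel (n + 2) (n + 1) from rfl)]
      simp [hs]

end Contraction

/-! ### The bar resolution. -/

section Bar

lemma barComplex_d {T : Type*} [Category* T] [Preadditive T] (L : Comonad T)
    [L.toFunctor.Additive] (A : T) (n : ℕ) :
    (barComplex L A).d (n + 1) n = barDiff L A (n + 1) :=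
  ChainComplex.of_d (fun n => barObj L A (n + 1)) (fun n => barDiff L A (n + 1)) n

variable {S : Type*} [Category* S] {T : Type*} [Category* T] {E : S ⥤ T} {F : T ⥤ S}
  (adj : E ⊣ F)

/-- The unit `F L^n A ⟶ F L^{n+1} A`. -/
def barUnit (A : T) (n : ℕ) :
    F.obj (barObj adj.toComonad A n) ⟶ F.obj (barObj adj.toComonad A (n + 1)) :=
  adj.unit.app (F.obj (barObj adj.toComonad A n))

lemma barUnit_comp_map_barCounit (A : T) (n : ℕ) :
    barUnit adj A n ≫ F.map (barCounit adj.toComonad A n) = 𝟙 _ :=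
  adj.right_triangle_components _

lemma barUnit_comp_map_barMap (A : T) {m n : ℕ}
    (f : barObj adj.toComonad A m ⟶ barObj adj.toComonad A n) :
    barUnit adj A m ≫ F.map (barMap adj.toComonad A f) = F.map f ≫ barUnit adj A n :=
  (adj.unit.naturality (F.map f)).symm

variable [Preadditive S] [Preadditive T] [F.Additive]

/-- The adjunct of `f` is `η ≫ F f`, which vanishes with `F f`. -/
lemma isProjective_obj (adj : E ⊣ F) (X : S) : IsProjective (kerIdeal F) (E.obj X) := by
  intro A f hf
  have hf : F.map f = 0 := hf
  apply (adj.homEquiv X A).injective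
  simp [Adjunction.homEquiv_unit, hf]

variable [E.Additive]

lemma map_barDiff_comp_barUnit_add (A : T) (n : ℕ) :
    F.map (barDiff adj.toComonad A n) ≫ barUnit adj A n +
      barUnit adj A (n + 1) ≫ F.map (barDiff adj.toComonad A (n + 1)) = 𝟙 _ := by
  rw [barDiff_succ, F.map_sub, Preadditive.comp_sub, barUnit_comp_map_barCounit,
    barUnit_comp_map_barMap, add_sub_cancel]

lemma isProjectiveResolution_barComplex (adj : E ⊣ F) (A : T) :
    IsProjectiveResolution F (A := A) (barComplex adj.toComonad A) (adj.counit.app A) := by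
  refine ⟨fun n => isProjective_obj adj _, ?_, ⟨?_⟩⟩
  · have h := barDiff_comp adj.toComonad A 0
    rw [barDiff_zero] at h
    rw [barComplex_d]
    exact h
  -- The contraction is split into cases because the objects of the augmented complex are themselves
  -- defined by cases on the degree.
  · refine homotopyOfContraction _ (fun | 0 => barUnit adj A 0 | n + 1 => barUnit adj A (n + 1))
      ?_ ?_
    · exact barUnit_comp_map_barCounit adj A 0
    · rintro (_ | n)
      · have h := map_barDiff_comp_barUnit_add adj A 0
        rw [barDiff_zero] at h
        rw [← barComplex_d] at h
        exact h
      · have h := map_barDiff_comp_barUnit_add adj A (n + 1)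
        rw [← barComplex_d, ← barComplex_d] at h
        exact h

end Bar

/-! ### Homotopy colimits of sequences. -/

section Codiagonal

variable {T : Type*} [Category* T] [HasCoproductsOfShape ℕ T] (A : T)

/-- The codiagonal of the direct sum of countably many copies of `A`. -/
noncomputable def codiagonal : (∐ fun _ : ℕ => A) ⟶ A :=
  Limits.Sigma.desc fun _ => 𝟙 A

@[simp]
lemma ι_codiagonal (n : ℕ) : Sigma.ι (fun _ : ℕ => A) n ≫ codiagonal A = 𝟙 A := by
  simp [codiagonal]

@[simp]
lemma ι_codiagonal_assoc (n : ℕ) {B : T} (f : A ⟶ B) :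
    Sigma.ι (fun _ : ℕ => A) n ≫ codiagonal A ≫ f = f := by
  simp [← Category.assoc]

end Codiagonal

section Telescope

variable {T : Type*} [Category* T] [Preadditive T] [HasCoproductsOfShape ℕ T]

/-- The morphism `id - shift` on the direct sum of a sequence of objects, whose cone is the homotopy
colimit of the sequence. -/
noncomputable def telescopeMap {N : ℕ → T} (ι : ∀ n, N n ⟶ N (n + 1)) : ∐ N ⟶ ∐ N :=
  Limits.Sigma.desc fun n => Sigma.ι N n - ι n ≫ Sigma.ι N (n + 1)

@[simp]
lemma ι_telescopeMap {N : ℕ → T} (ι : ∀ n, N n ⟶ N (n + 1)) (n : ℕ) :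
    Sigma.ι N n ≫ telescopeMap ι = Sigma.ι N n - ι n ≫ Sigma.ι N (n + 1) := by
  simp [telescopeMap]

@[simp]
lemma ι_telescopeMap_assoc {N : ℕ → T} (ι : ∀ n, N n ⟶ N (n + 1)) (n : ℕ) {B : T}
    (f : ∐ N ⟶ B) :
    Sigma.ι N n ≫ telescopeMap ι ≫ f =
      Sigma.ι N n ≫ f - ι n ≫ Sigma.ι N (n + 1) ≫ f := by
  rw [← Category.assoc, ι_telescopeMap, Preadditive.sub_comp, Category.assoc]

lemma telescopeMap_comp_map {M N : ℕ → T} (κ : ∀ n, M n ⟶ M (n + 1)) (ι : ∀ n, N n ⟶ N (n + 1))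
    (c : ∀ n, M n ⟶ N n) (hc : ∀ n, κ n ≫ c (n + 1) = c n ≫ ι n) :
    telescopeMap κ ≫ Limits.Sigma.map c = Limits.Sigma.map c ≫ telescopeMap ι := by
  refine Limits.Sigma.hom_ext _ _ fun n => ?_
  simp [Preadditive.comp_sub, ← Category.assoc (κ n), hc]

/-- The shift part of `id - shift` is built from the transition maps, so `F` kills it on every
summand; these are jointly epic after `F` because `F` preserves the coproduct. -/
lemma map_telescopeMap {S : Type*} [Category* S] [Preadditive S] (F : T ⥤ S) [F.Additive]
    [PreservesColimitsOfShape (Discrete ℕ) F] {N : ℕ → T} (ι : ∀ n, N n ⟶ N (n + 1))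
    (hι : ∀ n, F.map (ι n) = 0) : F.map (telescopeMap ι) = 𝟙 _ := by
  refine (isColimitOfPreserves F (colimit.isColimit (Discrete.functor N))).hom_ext ?_
  rintro ⟨n⟩
  change F.map (Sigma.ι N n) ≫ _ = F.map (Sigma.ι N n) ≫ _
  rw [← F.map_comp, ι_telescopeMap, F.map_sub, F.map_comp, hι]
  simp

variable (A : T)

/-- The retraction of `id - shift` on the direct sum of copies of `A`. -/
noncomputable def constTelescopeRetraction : (∐ fun _ : ℕ => A) ⟶ ∐ fun _ : ℕ => A :=
  Limits.Sigma.desc fun n => -∑ i ∈ Finset.range n, Sigma.ι (fun _ : ℕ => A) i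

@[simp]
lemma ι_constTelescopeRetraction (n : ℕ) :
    Sigma.ι (fun _ : ℕ => A) n ≫ constTelescopeRetraction A =
      -∑ i ∈ Finset.range n, Sigma.ι (fun _ : ℕ => A) i := by
  simp [constTelescopeRetraction]

/-- The partial sums attached to `n` and `n + 1` differ by exactly the `n`-th inclusion. -/
lemma telescopeMap_comp_retraction :
    telescopeMap (fun n => 𝟙 ((fun _ : ℕ => A) n)) ≫ constTelescopeRetraction A = 𝟙 _ := by
  refine Limits.Sigma.hom_ext _ _ fun n => ?_
  simp [Finset.sum_range_succ]

lemma telescopeMap_comp_codiagonal :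
    telescopeMap (fun n => 𝟙 ((fun _ : ℕ => A) n)) ≫ codiagonal A = 0 := by
  refine Limits.Sigma.hom_ext _ _ fun n => ?_
  simp

lemma retraction_telescopeMap_add_codiagonal_ι :
    constTelescopeRetraction A ≫ telescopeMap (fun n => 𝟙 ((fun _ : ℕ => A) n)) +
      codiagonal A ≫ Sigma.ι (fun _ : ℕ => A) 0 = 𝟙 _ := by
  refine Limits.Sigma.hom_ext _ _ fun n => ?_
  have h : ∑ i ∈ Finset.range n, Sigma.ι (fun _ : ℕ => A) i ≫
      telescopeMap (fun n => 𝟙 ((fun _ : ℕ => A) n)) =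
      Sigma.ι (fun _ : ℕ => A) 0 - Sigma.ι (fun _ : ℕ => A) n := by
    simp only [ι_telescopeMap, Category.id_comp]
    exact Finset.sum_range_sub' _ n
  rw [Preadditive.comp_add, ← Category.assoc, ι_constTelescopeRetraction, Preadditive.neg_comp,
    Preadditive.sum_comp, h, ι_codiagonal_assoc]
  simp

/-- The splitting of `id - shift` on the direct sum of copies of `A`. -/
noncomputable def constTelescopeIso [HasBinaryBiproducts T] :
    (∐ fun _ : ℕ => A) ≅ (∐ fun _ : ℕ => A) ⊞ A where
  hom := biprod.lift (constTelescopeRetraction A) (codiagonal A)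
  inv := biprod.desc (telescopeMap (fun n => 𝟙 ((fun _ : ℕ => A) n))) (Sigma.ι (fun _ : ℕ => A) 0)
  hom_inv_id := by rw [biprod.lift_desc, retraction_telescopeMap_add_codiagonal_ι]
  inv_hom_id := by
    ext <;> simp only [Category.assoc, biprod.inl_desc_assoc, biprod.inr_desc_assoc,
      biprod.lift_fst, biprod.lift_snd, telescopeMap_comp_retraction,
      telescopeMap_comp_codiagonal] <;> simp

variable [HasZeroObject T] [HasShift T ℤ] [∀ n : ℤ, (shiftFunctor T n).Additive]
  [Pretriangulated T]

/-- The homotopy colimit of a constant sequence is its value. -/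
lemma telescope_const_distinguished :
    Triangle.mk (telescopeMap (fun n => 𝟙 ((fun _ : ℕ => A) n))) (codiagonal A) 0 ∈
      distTriang T := by
  refine isomorphic_distinguished _
    (binaryBiproductTriangle_distinguished (∐ fun _ : ℕ => A) A) _
    (Triangle.isoMk _ _ (Iso.refl _) (constTelescopeIso A) (Iso.refl _) ?_ ?_ ?_)
  · change telescopeMap _ ≫ (constTelescopeIso A).hom = 𝟙 _ ≫ biprod.inl
    rw [Category.id_comp, ← Iso.eq_comp_inv]
    exact (biprod.inl_desc _ _).symm
  · change codiagonal A ≫ 𝟙 A = (constTelescopeIso A).hom ≫ biprod.snd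
    simp [constTelescopeIso]
  · exact zero_comp.trans comp_zero.symm

end Telescope

/-! ### Coproducts of morphisms with cone in a triangulated subcategory. -/

section Coproducts

variable {T : Type*} [Category* T] [Preadditive T] [HasZeroObject T] [HasShift T ℤ]
  [∀ n : ℤ, (shiftFunctor T n).Additive] [Pretriangulated T]

open Opposite

lemma trW_isStableUnderProductsOfShape {J : Type*} [HasProductsOfShape J T]
    (P : ObjectProperty T) [P.IsTriangulated] [P.IsClosedUnderLimitsOfShape (Discrete J)] :
    P.trW.IsStableUnderProductsOfShape J := by
  refine MorphismProperty.IsStableUnderProductsOfShape.mk _ _ ?_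
  intro X Y _ _ f hf
  choose Z g h hT hZ using hf
  exact ObjectProperty.trW.mk _
    (productTriangle_distinguished (fun j => Triangle.mk (f j) (g j) (h j)) hT)
    (P.prop_limit _ fun j => hZ j.as)

/-- Dual to the product case: in the opposite category the coproduct of the `f j` becomes a product,
and a product of distinguished triangles is distinguished. -/
lemma trW_sigma_map {J : Type*} [HasCoproductsOfShape J T]
    (P : ObjectProperty T) [P.IsTriangulated] [P.IsClosedUnderColimitsOfShape (Discrete J)]
    {X Y : J → T} (f : ∀ j, X j ⟶ Y j) (hf : ∀ j, P.trW (f j)) :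
    P.trW (Limits.Sigma.map f) := by
  have : P.op.IsClosedUnderLimitsOfShape (Discrete J) := by
    rw [P.op.isClosedUnderLimitsOfShape_iff_of_equivalence (Discrete.opposite J).symm]
    infer_instance
  have := trW_isStableUnderProductsOfShape (J := J) P.op
  have h : P.op.trW (Limits.Pi.map fun j => (f j).op) :=
    MorphismProperty.limMap _ fun j => P.trW_op_iff.2 (hf j.as)
  refine P.trW_of_op ((P.op.trW.arrow_mk_iso_iff ?_).2 h)
  refine Arrow.isoMk (opCoproductIsoProduct Y) (opCoproductIsoProduct X) ?_
  refine Limits.Pi.hom_ext _ _ fun j => ?_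
  dsimp
  rw [Category.assoc, Category.assoc, Pi.map_π, opCoproductIsoProduct_hom_comp_π,
    ← Category.assoc, opCoproductIsoProduct_hom_comp_π, ← op_comp, ← op_comp, Limits.Sigma.ι_map]

end Coproducts

/-! ### Localizing subcategories and orthogonality. -/

section Localizing

variable {T : Type*} [Category* T] [Preadditive T] [HasZeroObject T] [HasShift T ℤ]
  [∀ n : ℤ, (shiftFunctor T n).Additive] [Pretriangulated T]

lemma le_localizingClosure (P : ObjectProperty T) : P ≤ localizingClosure P :=
  fun _ hX _ _ hPQ => hPQ _ hX

lemma localizingClosure_le {P Q : ObjectProperty T} (hQ : IsLocalizing Q) (h : P ≤ Q) :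
    localizingClosure P ≤ Q :=
  fun _ hX => hX Q hQ h

lemma isLocalizing_localizingClosure (P : ObjectProperty T) :
    IsLocalizing (localizingClosure P) := by
  have iso_closed : (localizingClosure P).IsClosedUnderIsomorphisms := ⟨fun e hX Q hQ hPQ => by
    have := hQ.iso_closed
    exact Q.prop_of_iso e (hX Q hQ hPQ)⟩
  exact {
    iso_closed := iso_closed
    sum_closed := ⟨fun X ⟨p⟩ Q hQ hPQ => by
      have := hQ.sum_closed
      exact Q.prop_of_isColimit p.isColimit fun j => p.prop_diag_obj j Q hQ hPQ⟩
    isTriangulated :=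
      { exists_zero := ⟨_, isZero_zero T, fun Q hQ _ => by
          have := hQ.isTriangulated
          have := hQ.iso_closed
          exact Q.prop_zero⟩
        isStableUnderShiftBy := fun n => ⟨fun X hX Q hQ hPQ => by
          have := hQ.isTriangulated
          exact Q.le_shift n _ (hX Q hQ hPQ)⟩
        toIsTriangulatedClosed₂ := .mk' fun t ht h₁ h₃ Q hQ hPQ => by
          have := hQ.isTriangulated
          have := hQ.iso_closed
          exact Q.ext_of_isTriangulatedClosed₂ t ht (h₁ Q hQ hPQ) (h₃ Q hQ hPQ) } }

lemma isLocalizing_leftOrthogonal (N : ObjectProperty T) [N.IsStableUnderShift ℤ] :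
    IsLocalizing N.leftOrthogonal where
  isTriangulated := inferInstance
  iso_closed := inferInstance
  sum_closed := ⟨fun X ⟨p⟩ Y f hY =>
    p.isColimit.hom_ext fun j => by
      rw [comp_zero]
      exact p.prop_diag_obj j _ hY⟩

/-- If `L` is left orthogonal to `N` and every object is an extension of an object of `N` by an object
of `L`, then `L` is closed under retracts. -/
lemma isStableUnderRetracts_of_exists_triangle (L N : ObjectProperty T) [L.IsTriangulated]
    [L.IsClosedUnderIsomorphisms] (hom_eq_zero : ∀ ⦃P M : T⦄, L P → N M → ∀ f : P ⟶ M, f = 0)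
    (exists_triangle : ∀ A : T, ∃ (P M : T) (_ : L P) (_ : N M)
      (f : P ⟶ A) (g : A ⟶ M) (h : M ⟶ P⟦(1 : ℤ)⟧), Triangle.mk f g h ∈ distTriang T) :
    L.IsStableUnderRetracts where
  of_retract {A B} r hB := by
    obtain ⟨P, M, hP, hM, f, g, h, hT⟩ := exists_triangle A
    -- `g` factors through the retraction `B ⟶ A`, hence through a map from `L` to `N`.
    have hg : g = 0 := by
      rw [← Category.id_comp g, ← r.retract, Category.assoc, hom_eq_zero hB hM (r.r ≫ g), comp_zero]
    -- As `g = 0`, the identity of `M` factors through `P⟦1⟧`, which lies in `L`; so `M = 0` and `A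
    -- ≅ P`.
    obtain ⟨k, hk⟩ := Triangle.yoneda_exact₃ _ hT (𝟙 M) ((Category.comp_id g).trans hg)
    have hM0 : IsZero M := by
      rw [IsZero.iff_id_eq_zero]
      rw [hom_eq_zero (L.le_shift (1 : ℤ) _ hP) hM k] at hk
      exact hk.trans comp_zero
    have : IsIso f := (Triangle.isZero₃_iff_isIso₁ _ hT).1 hM0
    exact L.prop_of_iso (asIso f) hP

end Localizing

/-! ### The kernel of an exact functor. -/

section Kernel

variable {S : Type*} [Category* S] [Preadditive S] {T : Type*} [Category* T]

lemma contractibleObjects_kerIdeal_eq_kernel (F : T ⥤ S) :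
    contractibleObjects (kerIdeal F) = F.kernel := by
  ext N
  change F.map (𝟙 N) = 0 ↔ IsZero (F.obj N)
  rw [F.map_id, IsZero.iff_id_eq_zero]

lemma isStableUnderRetracts_kernel (F : T ⥤ S) : F.kernel.IsStableUnderRetracts where
  of_retract r h := IsZero.of_mono (F.map r.i) h

variable [HasZeroObject S] [HasShift S ℤ] [∀ n : ℤ, (shiftFunctor S n).Additive]
  [Pretriangulated S] [Preadditive T] [HasZeroObject T] [HasShift T ℤ]
  [∀ n : ℤ, (shiftFunctor T n).Additive] [Pretriangulated T]

lemma isTriangulated_kernel (F : T ⥤ S) [F.CommShift ℤ] [F.IsTriangulated] :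
    F.kernel.IsTriangulated := by
  have : ObjectProperty.IsTriangulated (IsZero : ObjectProperty S) :=
    { exists_zero := ⟨_, isZero_zero S, isZero_zero S⟩
      isStableUnderShiftBy := fun n => ⟨fun _ h => (shiftFunctor S n).map_isZero h⟩
      toIsTriangulatedClosed₂ := .mk' fun t ht h₁ h₃ => Triangle.isZero₂_of_isZero₁₃ t ht h₁ h₃ }
  infer_instance

end Kernel

/-! ### The approximation triangle. -/

section Approximation

variable {S : Type*} [Category* S] [Preadditive S]
  {T : Type*} [Category* T] [Preadditive T] [HasZeroObject T] [HasShift T ℤ]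
  [∀ n : ℤ, (shiftFunctor T n).Additive] [Pretriangulated T]

/-- The cone of the counit at `X` receives a morphism from `X` that is killed by `F`. -/
lemma exists_trW_map_eq_zero {E : S ⥤ T} {F : T ⥤ S} [F.Additive]
    (adj : E ⊣ F) (L : ObjectProperty T) [L.IsTriangulated] (hL : ObjectProperty.ofObj E.obj ≤ L)
    (X : T) : ∃ (Y : T) (f : X ⟶ Y), L.trW f ∧ F.map f = 0 := by
  obtain ⟨Y, f, h, hT⟩ := distinguished_cocone_triangle (X := E.obj (F.obj X)) (Y := X)
    (adj.counit.app X)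
  refine ⟨Y, f, ObjectProperty.trW.mk' _ hT (hL _ ⟨F.obj X⟩), ?_⟩
  have h₁ : F.map (adj.counit.app X) ≫ F.map f = 0 := by
    rw [← F.map_comp]
    exact (congrArg F.map (comp_distTriang_mor_zero₁₂ _ hT)).trans (F.map_zero _ _)
  -- `F` of the counit is a split epimorphism by the triangle identity, so `F f` vanishes.
  rw [← Category.id_comp (F.map f), ← adj.right_triangle_components, Category.assoc, h₁, comp_zero]

variable [HasZeroObject S] [HasShift S ℤ] [∀ n : ℤ, (shiftFunctor S n).Additive]
  [Pretriangulated S]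

/-- If every object maps to another one by a morphism with cone in the localizing subcategory `L` that
is killed by `F`, then it maps to an object of the kernel of `F` by a morphism with cone in `L`. -/
lemma exists_trW_kernel [IsTriangulated T] [HasCoproductsOfShape ℕ T]
    (F : T ⥤ S) [F.CommShift ℤ] [F.IsTriangulated] [PreservesColimitsOfShape (Discrete ℕ) F]
    {L : ObjectProperty T} (hL : IsLocalizing L)
    (step : ∀ X : T, ∃ (Y : T) (f : X ⟶ Y), L.trW f ∧ F.map f = 0) (A : T) :
    ∃ (M : T) (c : A ⟶ M), L.trW c ∧ F.kernel M := by
  have := hL.isTriangulated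
  have := hL.sum_closed
  choose cone f hf hFf using step
  let N : ℕ → T := fun n => Nat.rec A (fun _ X => cone X) n
  let ι : ∀ n, N n ⟶ N (n + 1) := fun n => f (N n)
  let c : ∀ n, A ⟶ N n := fun n => Nat.rec (𝟙 A) (fun n g => g ≫ ι n) n
  have hc : ∀ n, L.trW (c n) := fun n => by
    induction n with
    | zero => exact L.trW.id_mem A
    | succ n ih => exact L.trW.comp_mem _ _ ih (hf _)
  obtain ⟨M, g, h, hT⟩ := distinguished_cocone_triangle (telescopeMap ι)
  -- Compare the telescope triangle of the constant sequence `A` with that of `N`: both given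
  -- verticals have cone in `L`, so the third map `A ⟶ M` can be chosen with cone in `L`.
  obtain ⟨d, hd, -⟩ := MorphismProperty.compatible_with_triangulation (W := L.trW) _ _
    (telescope_const_distinguished A) hT (Limits.Sigma.map c) (Limits.Sigma.map c)
    (trW_sigma_map L c hc) (trW_sigma_map L c hc)
    (telescopeMap_comp_map _ _ _ fun n => Category.id_comp _)
  refine ⟨M, d, hd, (Triangle.isZero₃_iff_isIso₁ _ (F.map_distinguished _ hT)).2 ?_⟩
  change IsIso (F.map (telescopeMap ι))
  rw [map_telescopeMap F ι fun n => hFf _]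
  infer_instance

lemma isComplementary_localizingClosure_kernel [IsTriangulated T] [HasCoproductsOfShape ℕ T]
    (E : S ⥤ T) (F : T ⥤ S) [F.CommShift ℤ] [F.IsTriangulated]
    [PreservesColimitsOfShape (Discrete ℕ) F] (adj : E ⊣ F) :
    IsComplementary (localizingClosure (ObjectProperty.ofObj E.obj)) F.kernel := by
  have hL := isLocalizing_localizingClosure (ObjectProperty.ofObj E.obj)
  have := hL.isTriangulated
  have := hL.iso_closed
  have := isTriangulated_kernel F
  have hle : localizingClosure (ObjectProperty.ofObj E.obj) ≤ F.kernel.leftOrthogonal := by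
    refine localizingClosure_le (isLocalizing_leftOrthogonal _) ?_
    rintro _ ⟨X⟩ M f hM
    exact (adj.homEquiv X M).injective (IsZero.eq_of_tgt hM _ _)
  have hom_eq_zero : ∀ ⦃P M : T⦄, localizingClosure (ObjectProperty.ofObj E.obj) P →
      F.kernel M → ∀ f : P ⟶ M, f = 0 := fun P M hP hM f => hle P hP f hM
  have exists_triangle : ∀ A : T, ∃ (P M : T)
      (_ : localizingClosure (ObjectProperty.ofObj E.obj) P) (_ : F.kernel M)
      (f : P ⟶ A) (g : A ⟶ M) (h : M ⟶ P⟦(1 : ℤ)⟧), Triangle.mk f g h ∈ distTriang T := by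
    intro A
    obtain ⟨M, c, hc, hM⟩ := exists_trW_kernel F hL
      (exists_trW_map_eq_zero adj _ (le_localizingClosure _)) A
    obtain ⟨P, f, h, hT, hP⟩ := (ObjectProperty.trW_iff' _ _).1 hc
    exact ⟨P, M, hP, hM, f, c, h, hT⟩
  exact {
    left_triangulated := hL.isTriangulated
    left_thick := isStableUnderRetracts_of_exists_triangle _ _ hom_eq_zero exists_triangle
    right_triangulated := inferInstance
    right_thick := isStableUnderRetracts_kernel F
    hom_eq_zero := hom_eq_zero
    exists_triangle := exists_triangle }

end Approximation

end HomologicalIdeal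

theorem proposition2p1
    {S : Type*} [Category* S] [Preadditive S] [HasZeroObject S] [HasShift S ℤ]
    [∀ n : ℤ, (shiftFunctor S n).Additive] [Pretriangulated S] [IsTriangulated S]
    [HasCoproductsOfShape ℕ S]
    {T : Type*} [Category* T] [Preadditive T] [HasZeroObject T] [HasShift T ℤ]
    [∀ n : ℤ, (shiftFunctor T n).Additive] [Pretriangulated T] [IsTriangulated T]
    [HasCoproductsOfShape ℕ T]
    (E : S ⥤ T) [E.CommShift ℤ] [E.IsTriangulated] [PreservesColimitsOfShape (Discrete ℕ) E]
    (F : T ⥤ S) [F.CommShift ℤ] [F.IsTriangulated] [PreservesColimitsOfShape (Discrete ℕ) F]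
    (adj : E ⊣ F) :
    (∀ A : T, HomologicalIdeal.IsProjectiveResolution F (A := A)
      (HomologicalIdeal.barComplex adj.toComonad A) (adj.counit.app A)) ∧
    HomologicalIdeal.IsComplementary
      (HomologicalIdeal.localizingClosure (ObjectProperty.ofObj E.obj))
      (HomologicalIdeal.contractibleObjects (HomologicalIdeal.kerIdeal F)) := by
  refine ⟨fun A => HomologicalIdeal.isProjectiveResolution_barComplex adj A, ?_⟩
  rw [HomologicalIdeal.contractibleObjects_kerIdeal_eq_kernel]
  exact HomologicalIdeal.isComplementary_localizingClosure_kernel E F adj
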